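/- Let $G$ be a countable directed graph with vertex set $V(G)$, and let $\mathbb F^+(G)$ be its free semigroupoid, i.e. the set of all finite directed paths, the vertices being the paths of length $0$. Write $w=xwy$ if $w$ has source $x$ and range $y$. On $H_G=\ell^2(\mathbb F^+(G))$ with orthonormal basis $(\xi_w)$ let $L_w$ be the creation operator, $L_w\xi_h=\xi_{wh}$ if $wh$ is admissible and $L_w\xi_h=0$ otherwise. Let $W^*(G)$ be the weak closure of the $*$-algebra generated by all $L_w$, let $D_G$ be the weak closure of the $*$-algebra generated by the projections $L_v$, $v\in V(G)$, and let $E(a)=\sum_{v\in V(G)}\langle \xi_v,a\xi_v\rangle L_v$ be the canonical conditional expectation onto $D_G$. For $n\ge 1$ let $NC(n)$ be the lattice of noncrossing partitions of $\{1,\dots,n\}$ with Möbius function $\mu$ and maximal element $1_n$. For $\pi\in NC(n)$ let $\widehat E(\pi)(a_1\otimes\cdots\otimes a_n)$ be the partition-dependent $E$-moment: every block $(j_1<\dots<j_k)$ contributes $E(a_{j_1}m_2a_{j_2}\cdots m_ka_{j_k})$, where $m_t$ is the partition-dependent moment of the elements strictly between $j_{t-1}$ and $j_t$ ($m_t=1$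 if there are none), and the contributions of the outer blocks are multiplied in increasing order. The $D_G$-valued cumulants are $k_n(a_1,\dots,a_n)=\sum_{\pi\in NC(n)}\mu(\pi,1_n)\,\widehat E(\pi)(a_1\otimes\cdots\otimes a_n)$. For $w_1,\dots,w_n\in\mathbb F^+(G)$ and $u_1,\dots,u_n\in\{1,*\}$ put $$\mu_{w_1,\dots,w_n}^{u_1,\dots,u_n}=\sum_{\pi\in NC(n),\ \widehat E(\pi)(L_{w_1}^{u_1}\otimes\cdots\otimes L_{w_n}^{u_n})\ne 0}\mu(\pi,1_n).$$ For a bounded operator $a$ on $H_G$ and $w=xwy$ let $p_{w,1}=\langle\xi_w,a\xi_y\rangle$ and, if $w$ is not a vertex, $p_{w,*}=\langle\xi_y,a\xi_w\rangle$ be its Fourier coefficients (for a vertex $v$ only the exponent $1$ is used, and $p_v=p_{v,1}$). The support $\mathbb F^+(G:a)$ is the set of all $w$ with $p_{w,1}\neq 0$ or $p_{w,*}\ne0$; $V(G:a)$ is the set of vertices in it, and $loop_v(G:a)$ is the set of paths $w=vwv$ of positive length in it. **Theorem.** Let $a\in W^*(G)$ have a Fourier expansion $a=\sum_{w,u}p_{w,u}L_w^{u}$,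 in the sense that both sides have the same matrix entries with respect to $(\xi_w)$. Let $V=\{v_1,\dots,v_N\}\subset V(G)$ be finite and let $P_V(a)=\sum_{j=1}^N L_{v_j}aL_{v_j}$. Then, for every $d_1\in D_G$ with vertex coefficients $q_v=\langle\xi_v,d_1\xi_v\rangle$, $$k_1(d_1P_V(a))=\sum_{v\in V\cap V(G:d_1)\cap V(G:a)}q_vp_v\,L_v .$$ Moreover, for every $n>1$ and all $d_1,\dots,d_n\in D_G$ with vertex coefficients $q^{(k)}_{v}=\langle \xi_v,d_k\xi_v\rangle$, $$k_n(d_1P_V(a),\dots,d_nP_V(a))=\sum_{(v^{(1)},\dots,v^{(n)})\in\prod_{k}V(G:d_k)}\Big(\prod_{k=1}^nq^{(k)}_{v^{(k)}}\Big)\sum_{(w_1,u_1),\dots,(w_n,u_n)}\Big(\prod_{j=1}^np_{w_j,u_j}\Big)\Big(\prod_{k=1}^n\delta_{v^{(k)},x_k}\Big)\,\mu_{w_1,\dots,w_n}^{u_1,\dots,u_n}\,E\big(L_{w_1}^{u_1}\cdots L_{w_n}^{u_n}\big),$$ where $x_k$ is the source of $w_k$, each $w_j$ runs over $\big(\bigcup_{k=1}^Nloop_{v_k}(G:a)\big)\cup\big(V\cap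 V(G:a)\big)$ and $u_j\in\{1,*\}$ (only $u_j=1$ if $w_j$ is a vertex). The outer sum converges unconditionally. The inner sum is the iterated sum $\sum_{(w_n,u_n)}\big(\sum_{(w_{n-1},u_{n-1})}\cdots\big(\sum_{(w_1,u_1)}\cdots\big)\big)$, each of whose $n$ sums converges unconditionally in norm; if $a$ has finite support it is an ordinary finite sum. -/

import Mathlib

open scoped InnerProductSpace

universe u v

noncomputable section

/-! ### Free semigroupoid of a directed graph

A directed graph is a quiver: a type `V` of vertices with a type `x ⟶ y` of edges for all `x y`. -/

/-- The free semigroupoid `𝔽⁺(G)`: all finite directed paths `w = x w y` with source `x` and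
range `y`, the paths of length `0` being the vertices. -/
abbrev FreeSemigroupoid (V : Type u) [Quiver.{v} V] : Type (max u v) :=
  Σ x y : V, Quiver.Path x y

namespace FreeSemigroupoid

variable {V : Type u} [Quiver.{v} V]

/-- The source of a path. -/
def source (w : FreeSemigroupoid V) : V := w.1

/-- The range of a path. -/
def range (w : FreeSemigroupoid V) : V := w.2.1

/-- The number of edges of a path. -/
def length (w : FreeSemigroupoid V) : ℕ := w.2.2.length

/-- A vertex as an element of the free semigroupoid. -/
def vertex (x : V) : FreeSemigroupoid V := ⟨x, x, Quiver.Path.nil⟩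

open Classical in
/-- The partially defined product `w h`, which is admissible if and only if the range of `w`
is the source of `h`. -/
def concat (w h : FreeSemigroupoid V) : Option (FreeSemigroupoid V) :=
  if e : h.1 = w.2.1 then some ⟨w.1, h.2.1, w.2.2.comp (h.2.2.cast e rfl)⟩ else none

theorem concat_injective (w h h' g : FreeSemigroupoid V)
    (e : w.concat h = some g) (e' : w.concat h' = some g) : h = h' := by
  obtain ⟨x, y, p⟩ := w
  obtain ⟨a, b, q⟩ := h
  obtain ⟨a', b', q'⟩ := h'
  unfold concat at e e'
  split_ifs at e with h1
  split_ifs at e' with h2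
  dsimp only at h1 h2 e e'
  subst h1
  subst h2
  rw [← e] at e'
  simp only [Option.some.injEq, Sigma.mk.injEq, heq_eq_eq, true_and] at e'
  obtain ⟨rfl, e''⟩ := e'
  simp only [heq_eq_eq, Quiver.Path.cast_rfl_rfl, Quiver.Path.comp_inj_right] at e''
  rw [e'']

end FreeSemigroupoid

/-! ### Operators on the graph Hilbert space -/

/-- The graph Hilbert space `H_G = ℓ²(𝔽⁺(G))`. -/
abbrev GraphHilbert (V : Type u) [Quiver.{v} V] : Type (max u v) :=
  lp (fun _ : FreeSemigroupoid V => ℂ) 2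

/-- The bounded operators on the graph Hilbert space. -/
abbrev GraphOp (V : Type u) [Quiver.{v} V] : Type (max u v) :=
  GraphHilbert V →L[ℂ] GraphHilbert V

section Operators

variable {V : Type u} [Quiver.{v} V]

open Classical in
/-- The canonical orthonormal basis vector `ξ_w` of `H_G`. -/
def basisVec (w : FreeSemigroupoid V) : GraphHilbert V := lp.single 2 w (1 : ℂ)

theorem sum_concat_le (w : FreeSemigroupoid V) (f : GraphHilbert V)
    (s : Finset (FreeSemigroupoid V)) :
    ∑ h ∈ s, ‖(w.concat h).elim (0 : ℂ) f‖ ^ (2 : ENNReal).toReal ≤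
      ‖f‖ ^ (2 : ENNReal).toReal := by
  classical
  have key : ∑ h ∈ s, ‖(w.concat h).elim (0 : ℂ) f‖ ^ (2 : ENNReal).toReal =
      ∑ g ∈ s.filterMap w.concat (fun h h' g e e' => w.concat_injective h h' g e e'),
        ‖f g‖ ^ (2 : ENNReal).toReal := by
    rw [← Finset.sum_filter_add_sum_filter_not s (fun h => (w.concat h).isSome)]
    rw [Finset.sum_eq_zero (s := s.filter fun h => ¬ (w.concat h).isSome), add_zero]
    · refine Finset.sum_bij (fun h hh => (w.concat h).get (Finset.mem_filter.1 hh).2) ?_ ?_ ?_ ?_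
      · intro h hh
        rw [Finset.mem_filterMap]
        exact ⟨h, (Finset.mem_filter.1 hh).1, (Option.some_get _).symm⟩
      · intro h hh h' hh' e
        refine w.concat_injective h h' _ (Option.some_get (Finset.mem_filter.1 hh).2).symm ?_
        rw [e]
        exact (Option.some_get _).symm
      · intro g hg
        obtain ⟨h, hs, e⟩ := Finset.mem_filterMap _ |>.1 hg
        exact ⟨h, Finset.mem_filter.2 ⟨hs, by rw [e]; rfl⟩, by simp [e]⟩
      · intro h hh
        obtain ⟨g, e⟩ := Option.isSome_iff_exists.1 (Finset.mem_filter.1 hh).2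
        simp [e]
    · intro h hh
      rw [Finset.mem_filter, Option.not_isSome_iff_eq_none] at hh
      simp [hh.2]
  rw [key]
  exact lp.sum_rpow_le_norm_rpow (by norm_num) f _

/-- The annihilation operator `L_w^*`, given by `(L_w^* f)(h) = f(wh)` if `wh` is admissible and
`(L_w^* f)(h) = 0` otherwise; equivalently `L_w^* ξ_{wh} = ξ_h`, and `L_w^* ξ_g = 0` if `g` is not
of the form `wh`. -/
def annihilation (w : FreeSemigroupoid V) : GraphOp V :=
  LinearMap.mkContinuous
    { toFun := fun f => ⟨fun h => (w.concat h).elim (0 : ℂ) f,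
        memℓp_gen' (C := ‖f‖ ^ (2 : ENNReal).toReal) (sum_concat_le w f)⟩
      map_add' := by
        intro f g
        ext h
        simp only [lp.coeFn_add, Pi.add_apply]
        cases w.concat h <;> simp
      map_smul' := by
        intro c f
        ext h
        simp only [lp.coeFn_smul, Pi.smul_apply, RingHom.id_apply]
        cases w.concat h <;> simp }
    1 (by
      intro f
      rw [one_mul]
      exact lp.norm_le_of_forall_sum_le (by norm_num) (norm_nonneg f) (sum_concat_le w f))

/-- The creation operator `L_w`, the adjoint of the annihilation operator. -/
def creation (w : FreeSemigroupoid V) : GraphOp V := ContinuousLinearMap.adjoint (annihilation w)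

/-- The creation operator is left multiplication by `w`: one has `L_w ξ_h = ξ_{wh}` if `wh` is
admissible and `L_w ξ_h = 0` otherwise. -/
theorem creation_basisVec (w h : FreeSemigroupoid V) :
    creation w (basisVec h) = (w.concat h).elim 0 basisVec := by
  classical
  refine ext_inner_right ℂ fun f => ?_
  rw [creation, ContinuousLinearMap.adjoint_inner_left, basisVec, lp.inner_single_left]
  change ⟪(1 : ℂ), (w.concat h).elim (0 : ℂ) f⟫_ℂ = _
  rcases w.concat h with _ | g
  · simp
  · simp [basisVec, lp.inner_single_left]

/-- The projection `L_x` of a vertex `x`. -/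
def vertexProj (x : V) : GraphOp V := creation (FreeSemigroupoid.vertex x)

/-- The set of operators in the weak operator closure of the `*`-algebra generated by `S`. -/
def weakStarAlgebra (S : Set (GraphOp V)) : Set (GraphOp V) :=
  {a | ContinuousLinearMapWOT.ofCLM a ∈
    closure (ContinuousLinearMapWOT.ofCLM '' (StarAlgebra.adjoin ℂ S : Set (GraphOp V)))}

variable (V) in
/-- The graph `W*`-algebra `W*(G)`. -/
def graphWStar : Set (GraphOp V) := weakStarAlgebra (Set.range creation)

variable (V) in
/-- The diagonal subalgebra `D_G`. -/
def diagonalSubalgebra : Set (GraphOp V) := weakStarAlgebra (Set.range vertexProj)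

theorem norm_vacuum_le (a : GraphOp V) (x : V) :
    ‖⟪basisVec (FreeSemigroupoid.vertex x), a (basisVec (FreeSemigroupoid.vertex x))⟫_ℂ‖ ≤ ‖a‖ := by
  classical
  have h1 : ‖basisVec (FreeSemigroupoid.vertex x)‖ = 1 := by
    simp [basisVec, lp.norm_single (p := 2) (by norm_num)]
  calc _ ≤ ‖basisVec (FreeSemigroupoid.vertex x)‖ * ‖a (basisVec (FreeSemigroupoid.vertex x))‖ :=
        norm_inner_le_norm _ _
    _ ≤ 1 * (‖a‖ * 1) := by
        rw [h1]
        have := a.le_opNorm (basisVec (FreeSemigroupoid.vertex x))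
        rw [h1] at this
        gcongr
    _ = ‖a‖ := by ring

theorem sum_condExp_le (a : GraphOp V) (f : GraphHilbert V) (s : Finset (FreeSemigroupoid V)) :
    ∑ h ∈ s, ‖⟪basisVec (FreeSemigroupoid.vertex h.source),
        a (basisVec (FreeSemigroupoid.vertex h.source))⟫_ℂ * f h‖ ^ (2 : ENNReal).toReal ≤
      (‖a‖ * ‖f‖) ^ (2 : ENNReal).toReal := by
  rw [Real.mul_rpow (norm_nonneg _) (norm_nonneg _)]
  refine le_trans (Finset.sum_le_sum (g := fun h => ‖a‖ ^ (2 : ENNReal).toReal *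
    ‖f h‖ ^ (2 : ENNReal).toReal) fun h _ => ?_) ?_
  · rw [norm_mul, Real.mul_rpow (norm_nonneg _) (norm_nonneg _)]
    gcongr
    exact norm_vacuum_le a _
  · rw [← Finset.mul_sum]
    gcongr
    exact lp.sum_rpow_le_norm_rpow (by norm_num) f _

/-- The canonical conditional expectation onto `D_G`: `E(a) = ∑_x p_x L_x` with
`p_x = ⟨ξ_x, a ξ_x⟩`, the sum being over all vertices `x`; that is, `E(a)` multiplies the
`h`-th coordinate by `p_x` where `x` is the source of `h`. It is written for all bounded
operators, and it is used on `W*(G)`. -/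
def condExp (a : GraphOp V) : GraphOp V :=
  LinearMap.mkContinuous
    { toFun := fun f => ⟨fun h => ⟪basisVec (FreeSemigroupoid.vertex h.source),
          a (basisVec (FreeSemigroupoid.vertex h.source))⟫_ℂ * f h,
        memℓp_gen' (C := (‖a‖ * ‖f‖) ^ (2 : ENNReal).toReal) (sum_condExp_le a f)⟩
      map_add' := by
        intro f g
        ext h
        simp only [lp.coeFn_add, Pi.add_apply, mul_add]
      map_smul' := by
        intro c f
        ext h
        simp [mul_left_comm] }
    ‖a‖ (by
      intro f
      exact lp.norm_le_of_forall_sum_le (by norm_num) (by positivity) (sum_condExp_le a f))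

/-- The diagonal compression `P_S(a) = ∑_{x ∈ S} L_x a L_x`. -/
def diagonalCompression (S : Finset V) (a : GraphOp V) : GraphOp V :=
  ∑ x ∈ S, vertexProj x * a * vertexProj x

end Operators

/-! ### Fourier expansions -/

/-- The exponents `1` and `*`. -/
inductive Exponent
  | one
  | star

/-- The index set of the Fourier expansion: pairs `(w, u)` with `w ∈ 𝔽⁺(G)` and `u ∈ {1, *}`,
where only `u = 1` is used if `w` is a vertex, as `L_x = L_x^*` for a vertex `x`. -/
abbrev FourierIndex (V : Type u) [Quiver.{v} V] : Type (max u v) :=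
  {i : FreeSemigroupoid V × Exponent // i.2 = Exponent.star → 0 < i.1.length}

section Fourier

variable {V : Type u} [Quiver.{v} V]

/-- The path `w` of the index `(w, u)`. -/
def FourierIndex.path (i : FourierIndex V) : FreeSemigroupoid V := i.1.1

/-- The index `(x, 1)` of a vertex `x`. -/
def FourierIndex.ofVertex (x : V) : FourierIndex V :=
  ⟨(FreeSemigroupoid.vertex x, Exponent.one), fun h => by cases h⟩

/-- The operator `L_w^u` of the index `(w, u)`. -/
def FourierIndex.op (i : FourierIndex V) : GraphOp V :=
  match i.1.2 with
  | Exponent.one => creation i.1.1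
  | Exponent.star => annihilation i.1.1

/-- The Fourier coefficient of `a` at `L_w^u`, where `y` is the range of `w`: it is
`⟨ξ_w, a ξ_y⟩` for `u = 1` and `⟨ξ_y, a ξ_w⟩` for `u = *`. -/
def graphFourierCoeff (a : GraphOp V) (i : FourierIndex V) : ℂ :=
  match i.1.2 with
  | Exponent.one => ⟪basisVec i.1.1, a (basisVec (FreeSemigroupoid.vertex i.1.1.range))⟫_ℂ
  | Exponent.star => ⟪basisVec (FreeSemigroupoid.vertex i.1.1.range), a (basisVec i.1.1)⟫_ℂ

/-- The operator `a` is the sum of its Fourier series `∑ p_w L_w^{u_w}`, in the weakest sense,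
that of matrix entries with respect to the basis `(ξ_w)`. -/
def HasFourierExpansion (a : GraphOp V) : Prop :=
  ∀ g h : FreeSemigroupoid V,
    HasSum (fun i : FourierIndex V => graphFourierCoeff a i * ⟪basisVec g, i.op (basisVec h)⟫_ℂ)
      ⟪basisVec g, a (basisVec h)⟫_ℂ

/-- The support `𝔽⁺(G : a)`. -/
def fourierSupport (a : GraphOp V) : Set (FreeSemigroupoid V) :=
  {w | ∃ i : FourierIndex V, i.path = w ∧ graphFourierCoeff a i ≠ 0}

/-- The vertex part `V(G : a)` of the support. -/
def vertexSupport (a : GraphOp V) : Set V := {x | FreeSemigroupoid.vertex x ∈ fourierSupport a}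

/-- The loops `loop_x(G : a)` based at `x` in the support of `a`. -/
def loopSupport (a : GraphOp V) (x : V) : Set (FreeSemigroupoid V) :=
  {w | w ∈ fourierSupport a ∧ 0 < w.length ∧ w.source = x ∧ w.range = x}

/-- The indices `(w, u)` with `w` in
`(⋃_{x ∈ S} loop_x(G : a)) ∪ (S ∩ V(G : a))`. -/
def compressedIndices (S : Finset V) (a : GraphOp V) : Set (FourierIndex V) :=
  {i | i.path ∈ (⋃ x ∈ S, loopSupport a x) ∪
    FreeSemigroupoid.vertex '' ((S : Set V) ∩ vertexSupport a)}

end Fourier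

/-! ### Noncrossing partitions and operator-valued cumulants -/

/-- The lattice `NC(n)` of noncrossing partitions of `{0, …, n - 1}`, ordered by refinement
(`π ≤ σ` if every block of `π` is contained in a block of `σ`). -/
abbrev NC (n : ℕ) : Type :=
  {π : Setoid (Fin n) //
    ∀ i j k l : Fin n, i < j → j < k → k < l → π i k → π j l → π i j}

namespace NC

instance (n : ℕ) : Finite (NC n) :=
  Finite.of_injective (fun π : NC n => fun i j : Fin n => π.1 i j) fun π σ h =>
    Subtype.ext (Setoid.ext fun i j => by
      have := congrFun (congrFun h i) j
      exact Iff.of_eq this)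

instance (n : ℕ) : Fintype (NC n) := Fintype.ofFinite _

open Classical in
instance (n : ℕ) : LocallyFiniteOrder (NC n) := Fintype.toLocallyFiniteOrder

/-- The maximal partition `1_n`, with only one block. -/
def one (n : ℕ) : NC n := ⟨⊤, fun _ _ _ _ _ _ _ _ _ => trivial⟩

open Classical in
/-- The value `μ(π, 1_n)` of the Möbius function of `NC(n)`. -/
def moebius {n : ℕ} (π : NC n) : ℂ := IncidenceAlgebra.mu ℂ π (one n)

end NC

section Cumulants

variable {ι A : Type*} [Ring A]

open Classical in
mutual
/-- The partition dependent moment along an increasing list of indices, for the partition `r`: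
every block `(j_1 < ⋯ < j_k)` contributes `E(a_{j_1} m_2 a_{j_2} ⋯ m_k a_{j_k})`, where `m_t` is the
partition dependent moment along the indices strictly between `j_{t-1}` and `j_t` (and `m_t = 1`
if there are none). The contributions of the outer blocks are multiplied in increasing order. -/
def momentList (E : A → A) (r : Setoid ι) (a : ι → A) : List ι → A
  | [] => 1
  | i :: l => momentBlock E r a (a i) i l
termination_by l => (l.length, 0)

/-- Auxiliary part of `momentList`: the block of `i` is being read, `c` is the product for the part
of it that has been read, and `l` is the list of the remaining indices. -/
def momentBlock (E : A → A) (r : Setoid ι) (a : ι → A) (c : A) (i : ι) (l : List ι) : A :=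
  match _h : l.dropWhile (fun k => ¬ r i k) with
  | [] => E c * momentList E r a l
  | k :: l' =>
    momentBlock E r a (c * momentList E r a (l.takeWhile (fun k => ¬ r i k)) * a k) k l'
termination_by (l.length, 1)
decreasing_by
  · exact Prod.Lex.right _ (by norm_num)
  · rcases (List.takeWhile_prefix (p := fun k => decide (¬ r i k)) (l := l)).length_le.lt_or_eq
      with h | h
    · exact Prod.Lex.left _ _ h
    · rw [h]
      exact Prod.Lex.right _ (by norm_num)
  · refine Prod.Lex.left _ _ ?_
    have := (List.dropWhile_suffix (fun k => decide (¬ r i k)) (l := l)).length_le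
    rw [_h] at this
    simpa using this
end

/-- The partition dependent moment `Ê(π)(a_1 ⊗ ⋯ ⊗ a_n)`: the value at `π` of the moment
multiplicative bimodule map induced by `E`. -/
def partitionMoment (E : A → A) {n : ℕ} (π : NC n) (a : Fin n → A) : A :=
  momentList E π.1 a (List.finRange n)

/-- The `n`-th operator-valued cumulant
`k_n(a_1, …, a_n) = ∑_{π ∈ NC(n)} μ(π, 1_n) Ê(π)(a_1 ⊗ ⋯ ⊗ a_n)`. -/
def cumulant [Algebra ℂ A] (E : A → A) {n : ℕ} (a : Fin n → A) : A :=
  ∑ π : NC n, π.moebius • partitionMoment E π a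

end Cumulants

section Coefficients

variable {V : Type u} [Quiver.{v} V]

open Classical in
/-- The set `C_{w_1,…,w_n}^{u_1,…,u_n}` of the partitions `π ∈ NC(n)` such that
`L_{w_1}^{u_1} ⋯ L_{w_n}^{u_n}` is `π`-connected. -/
def connectedPartitions {n : ℕ} (w : Fin n → FourierIndex V) : Finset (NC n) :=
  {π | partitionMoment condExp π (fun j => (w j).op) ≠ 0}

/-- The number `μ_{w_1,…,w_n}^{u_1,…,u_n}`. -/
def moebiusNumber {n : ℕ} (w : Fin n → FourierIndex V) : ℂ :=
  ∑ π ∈ connectedPartitions w, π.moebius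

end Coefficients

/-- The iterated sum `∑_{x_n} (∑_{x_{n-1}} ⋯ (∑_{x_1} f(x_1, …, x_n)))` exists and equals `s`, where
each of the `n` sums is unconditionally convergent. -/
def HasIteratedSum {ι M : Type*} [AddCommMonoid M] [TopologicalSpace M] :
    (n : ℕ) → ((Fin n → ι) → M) → M → Prop
  | 0, f, s => f Fin.elim0 = s
  | n + 1, f, s => ∃ g : ι → M,
      (∀ i, HasIteratedSum n (fun x => f (Fin.snoc (α := fun _ => ι) x i)) (g i)) ∧ HasSum g s

end

-- The formula combines three facts.
--
-- Vertices: an element `d` of `D_G` multiplies every path with source `x` by one scalar `q_x`, so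
-- `d P_V(a)` is the finite sum of `q_x L_x P_V(a)` over the vertices of `V`. Multilinearity of the
-- cumulant gives the outer sum, which has only finitely many nonzero terms
-- (`hasSum_cumulant_mul_diagonalCompression`).
--
-- Monomials: a product of operators `L_w^u` acts as a partial map of paths compatible with right
-- multiplication. Hence `E` either kills it or fixes it, every nonzero partition dependent moment
-- is the plain product, and the cumulant is the Möbius number times `E` of that product
-- (`moebiusNumber_smul_condExp_prod`).
--
-- Convergence: for fixed `h`, the nonzero vectors `L_w^u ξ_h` are distinct basis vectors, so the
-- Fourier series of `a` converges in norm on each `ξ_h` (`HasFourierExpansion.hasSum_basisVec`).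
-- This convergence survives `E` and multiplication on the left by anything, but multiplication on
-- the right is safe only by operators sending each basis vector to a multiple of a basis vector.
-- This dictates the order of the iterated sum: when the `k`-th argument is expanded, the later ones
-- must already be single Fourier terms (`HasSumOnBasis.partitionMoment`). Finally all moments
-- involved lie in the span of the finitely many `L_x` with `x` in `V`, so convergence of their
-- vacuum coefficients is convergence in norm (`cumulant_eq_sum_vertexProj`).

noncomputable section

/-! ### Partition dependent moments -/

section Moments

variable {ι A : Type*} [Ring A] {E : A → A} {r : Setoid ι} {a : ι → A}

open Classical in
theorem momentBlock_of_dropWhile_eq_nil {c : A} {i : ι} {l : List ι}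
    (h : l.dropWhile (fun k => ¬ r i k) = []) :
    momentBlock E r a c i l = E c * momentList E r a l := by
  rw [momentBlock.eq_1]
  split
  · rfl
  · rename_i h'
    rw [h] at h'
    cases h'

open Classical in
theorem momentBlock_of_dropWhile_eq_cons {c : A} {i j : ι} {l l' : List ι}
    (h : l.dropWhile (fun k => ¬ r i k) = j :: l') :
    momentBlock E r a c i l = momentBlock E r a
      (c * momentList E r a (l.takeWhile (fun k => ¬ r i k)) * a j) j l' := by
  rw [momentBlock.eq_1]
  split
  · rename_i h'
    rw [h] at h'
    cases h'
  · rename_i h'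
    rw [h] at h'
    cases h'
    rfl

/-- Induction along the recursion that defines the partition dependent moments. -/
theorem moment_induction (r : Setoid ι) {motive1 : List ι → Prop} {motive2 : ι → List ι → Prop}
    (nil : motive1 []) (cons : ∀ i l, motive2 i l → motive1 (i :: l))
    (last : ∀ i l, (∀ (E : A → A) (a : ι → A) c,
      momentBlock E r a c i l = E c * momentList E r a l) → motive1 l → motive2 i l)
    (next : ∀ i t j l, (∀ (E : A → A) (a : ι → A) c,
      momentBlock E r a c i (t ++ j :: l) = momentBlock E r a (c * momentList E r a t * a j) j l) →
      motive1 t → motive2 j l → motive2 i (t ++ j :: l)) :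
    (∀ l, motive1 l) ∧ ∀ i l, motive2 i l := by
  classical
  -- The recursion depends only on `r` and the list, so `id` and `0` serve as dummies for `E` and
  -- `a`; the hypotheses `last` and `next` hold for all of them.
  have := momentList.mutual_induct (A := A) id r 0 motive1 (fun _ => motive2) nil cons
    (fun _ i l h => last i l fun E a c => momentBlock_of_dropWhile_eq_nil h)
    (fun _ i l j l' h h1 h2 => by
      have e := List.takeWhile_append_dropWhile (p := fun k => decide (¬ r i k)) (l := l)
      rw [h] at e
      have := next i _ j l' (fun E a c => by
        rw [e]
        exact momentBlock_of_dropWhile_eq_cons h) h1 h2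
      rwa [e] at this)
  exact ⟨this.1, fun i l => this.2 0 i l⟩

theorem momentList_nil : momentList E r a [] = 1 := momentList.eq_1 ..

theorem momentList_cons (i : ι) (l : List ι) :
    momentList E r a (i :: l) = momentBlock E r a (a i) i l := momentList.eq_2 ..

theorem momentList_congr {a' : ι → A} (l : List ι) (h : ∀ j ∈ l, a j = a' j) :
    momentList E r a l = momentList E r a' l := by
  refine (moment_induction (A := A) r
    (motive1 := fun l => (∀ j ∈ l, a j = a' j) → momentList E r a l = momentList E r a' l)
    (motive2 := fun i l => (∀ j ∈ l, a j = a' j) →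
      ∀ c, momentBlock E r a c i l = momentBlock E r a' c i l) ?_ ?_ ?_ ?_).1 l h
  · intro _
    rw [momentList_nil, momentList_nil]
  · intro i l ih h
    rw [momentList_cons, momentList_cons, h i (by simp), ih fun j hj => h j (by simp [hj])]
  · intro i l e ih h c
    rw [e, e, ih h]
  · intro i t j l e ih1 ih2 h c
    rw [e, e, ih1 fun k hk => h k (by simp [hk]), h j (by simp),
      ih2 fun k hk => h k (by simp [hk])]

theorem momentList_mem {M : Submonoid A} (hE : ∀ x ∈ M, E x ∈ M) (l : List ι)
    (h : ∀ j ∈ l, a j ∈ M) : momentList E r a l ∈ M := by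
  refine (moment_induction (A := A) r
    (motive1 := fun l => (∀ j ∈ l, a j ∈ M) → momentList E r a l ∈ M)
    (motive2 := fun i l => (∀ j ∈ l, a j ∈ M) →
      ∀ c ∈ M, momentBlock E r a c i l ∈ M) ?_ ?_ ?_ ?_).1 l h
  · intro _
    rw [momentList_nil]
    exact M.one_mem
  · intro i l ih h
    rw [momentList_cons]
    exact ih (fun j hj => h j (by simp [hj])) _ (h i (by simp))
  · intro i l e ih h c hc
    rw [e]
    exact M.mul_mem (hE c hc) (ih h)
  · intro i t j l e ih1 ih2 h c hc
    rw [e]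
    exact ih2 (fun k hk => h k (by simp [hk])) _
      (M.mul_mem (M.mul_mem hc (ih1 fun k hk => h k (by simp [hk]))) (h j (by simp)))

/-- If every element `x` of a monoid with `E x ≠ 0` is fixed by `E`, then a nonzero partition
dependent moment of elements of the monoid is their product. -/
theorem momentList_eq_prod {M : Submonoid A} (h0 : 0 ∈ M) (hE : ∀ x ∈ M, E x ≠ 0 → E x = x)
    (l : List ι) (h : ∀ j ∈ l, a j ∈ M) (hne : momentList E r a l ≠ 0) :
    momentList E r a l = (l.map a).prod := by
  have hEM : ∀ x ∈ M, E x ∈ M := fun x hx => by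
    by_cases e : E x = 0
    · rwa [e]
    · rwa [hE x hx e]
  refine (moment_induction (A := A) r
    (motive1 := fun l => (∀ j ∈ l, a j ∈ M) → momentList E r a l ≠ 0 →
      momentList E r a l = (l.map a).prod)
    -- The conjunct `c ≠ 0` is needed in the `next` case: there the accumulated product contains an
    -- inner moment, which must be nonzero for the induction hypothesis to apply to it.
    (motive2 := fun i l => (∀ j ∈ l, a j ∈ M) → ∀ c ∈ M, momentBlock E r a c i l ≠ 0 →
      momentBlock E r a c i l = c * (l.map a).prod ∧ c ≠ 0) ?_ ?_ ?_ ?_).1 l h hne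
  · intro _ _
    rw [momentList_nil, List.map_nil, List.prod_nil]
  · intro i l ih h
    rw [momentList_cons]
    intro hne
    rw [(ih (fun j hj => h j (by simp [hj])) _ (h i (by simp)) hne).1, List.map_cons,
      List.prod_cons]
  · intro i l e ih h c hc
    rw [e]
    intro hne
    have hc' := hE c hc (left_ne_zero_of_mul hne)
    rw [hc'] at hne ⊢
    exact ⟨by rw [ih h (right_ne_zero_of_mul hne)], left_ne_zero_of_mul hne⟩
  · intro i t j l e ih1 ih2 h c hc
    rw [e]
    intro hne
    have ht : ∀ k ∈ t, a k ∈ M := fun k hk => h k (by simp [hk])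
    obtain ⟨e1, e2⟩ := ih2 (fun k hk => h k (by simp [hk])) _
      (M.mul_mem (M.mul_mem hc (momentList_mem hEM t ht)) (h j (by simp))) hne
    have e3 := left_ne_zero_of_mul e2
    rw [e1, ih1 ht (right_ne_zero_of_mul e3)]
    exact ⟨by simp [mul_assoc], left_ne_zero_of_mul e3⟩

/-- A moment is `1` or a product of values of `E`, one for each outer block, and such products are
fixed by the left module property. -/
theorem map_momentList (h1 : E 1 = 1) (hE : ∀ x y, E (E x * y) = E x * E y) (l : List ι) :
    E (momentList E r a l) = momentList E r a l := by
  refine (moment_induction (A := A) r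
    (motive1 := fun l => E (momentList E r a l) = momentList E r a l)
    (motive2 := fun i l => ∀ c, E (momentBlock E r a c i l) = momentBlock E r a c i l)
    ?_ ?_ ?_ ?_).1 l
  · rw [momentList_nil, h1]
  · intro i l ih
    rw [momentList_cons, ih]
  · intro i l e ih c
    rw [e, hE, ih]
  · intro i t j l e ih1 ih2 c
    rw [e, ih2]

/-- The first argument is the leftmost factor of the first outer block. With `p` a vertex
projection, this confines moments to the vertices on which the first argument lives. -/
theorem mul_momentList_eq_zero {p : A} (hE : ∀ x, p * x = 0 → p * E x = 0) (i : ι) (l : List ι)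
    (hp : p * a i = 0) : p * momentList E r a (i :: l) = 0 := by
  rw [momentList_cons]
  refine (moment_induction (A := A) r (motive1 := fun _ => True)
    (motive2 := fun i l => ∀ c, p * c = 0 → p * momentBlock E r a c i l = 0)
    ?_ ?_ ?_ ?_).2 i l _ hp
  · trivial
  · intros
    trivial
  · intro i l e _ c hc
    rw [e, ← mul_assoc, hE c hc, zero_mul]
  · intro i t j l e _ ih2 c hc
    rw [e]
    exact ih2 _ (by rw [← mul_assoc, ← mul_assoc, hc, zero_mul, zero_mul])

/-- A property of families in `A` that is stable under left multiplication, under right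
multiplication by elements of `M` and under `E` passes from one argument of a partition dependent
moment to the moment, provided that the later arguments belong to `M`. -/
theorem momentList_update {ι T : Type*} [LinearOrder ι] {r : Setoid ι} {M : Submonoid A}
    (hM : ∀ x ∈ M, E x ∈ M) {Q : (T → A) → Prop} (hl : ∀ c X, Q X → Q fun t => c * X t)
    (hr : ∀ X, ∀ m ∈ M, Q X → Q fun t => X t * m) (hE : ∀ X, Q X → Q fun t => E (X t))
    {k : ι} {x : T → A} (hx : Q x) {b : ι → A} (hb : ∀ j, k < j → b j ∈ M) (l : List ι)
    (hlt : l.Pairwise (· < ·)) (hk : k ∈ l) :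
    Q fun t => momentList E r (Function.update b k (x t)) l := by
  have const : ∀ l : List ι, k ∉ l → ∀ t,
      momentList E r (Function.update b k (x t)) l = momentList E r b l := fun l h t =>
    momentList_congr l fun j hj => Function.update_of_ne (by rintro rfl; exact h hj) _ _
  refine (moment_induction (A := A) r
    (motive1 := fun l => l.Pairwise (· < ·) → k ∈ l →
      Q fun t => momentList E r (Function.update b k (x t)) l)
    -- Either `k` is still to be read and the accumulated factor is constant, or `k` has been read
    -- and the accumulated factor `C` carries the dependence on `t`; in the second case all later
    -- factors come on its right and lie in `M`.
    (motive2 := fun i l => l.Pairwise (· < ·) →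
      (k ∈ l → ∀ c, Q fun t => momentBlock E r (Function.update b k (x t)) c i l) ∧
      ((∀ j ∈ l, k < j) → ∀ C, Q C →
        Q fun t => momentBlock E r (Function.update b k (x t)) (C t) i l)) ?_ ?_ ?_ ?_).1 l hlt hk
  · intro _ h
    simp at h
  · intro i l ih hlt hk
    rw [List.pairwise_cons] at hlt
    simp only [momentList_cons]
    rcases List.mem_cons.1 hk with rfl | hk
    · simpa using (ih hlt.2).2 hlt.1 x hx
    · have hne : i ≠ k := (hlt.1 k hk).ne
      simpa [Function.update_of_ne hne] using (ih hlt.2).1 hk (b i)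
  · intro i l e ih hlt
    simp only [e]
    refine ⟨fun hk c => hl _ _ (ih hlt hk), fun h C hC => ?_⟩
    simp only [const l fun hk => (h k hk).false]
    exact hr _ _ (momentList_mem hM l fun j hj => hb j (h j hj)) (hE _ hC)
  · intro i t j l e ih1 ih2 hlt
    simp only [e]
    obtain ⟨ht, hjl, htj⟩ := List.pairwise_append.1 hlt
    rw [List.pairwise_cons] at hjl
    refine ⟨fun hk c => ?_, fun h C hC => ?_⟩
    · rcases List.mem_append.1 hk with hk | hk
      · have hj : k < j := htj k hk j (by simp)
        simp only [Function.update_of_ne hj.ne']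
        exact (ih2 hjl.2).2 (fun m hm => hj.trans (hjl.1 m hm)) _
          (hr _ _ (hb j hj) (hl _ _ (ih1 ht hk)))
      · have hkt : k ∉ t := fun h => (htj k h k hk).false
        simp only [const t hkt]
        rcases List.mem_cons.1 hk with rfl | hk
        · simp only [Function.update_self]
          exact (ih2 hjl.2).2 hjl.1 _ (hl _ _ hx)
        · have hj : j ≠ k := (hjl.1 k hk).ne
          simp only [Function.update_of_ne hj]
          exact (ih2 hjl.2).1 hk _
    · have hj : k < j := h j (by simp)
      have ht' : ∀ m ∈ t, k < m := fun m hm => h m (by simp [hm])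
      simp only [const t fun hk => (ht' k hk).false, Function.update_of_ne hj.ne']
      exact (ih2 hjl.2).2 (fun m hm => h m (by simp [hm])) _ (hr _ _ (hb j hj)
        (hr _ _ (momentList_mem hM t fun m hm => hb m (ht' m hm)) hC))

theorem partitionMoment_update {T : Type*} {M : Submonoid A}
    (hM : ∀ x ∈ M, E x ∈ M) {Q : (T → A) → Prop} (hl : ∀ c X, Q X → Q fun t => c * X t)
    (hr : ∀ X, ∀ m ∈ M, Q X → Q fun t => X t * m) (hE : ∀ X, Q X → Q fun t => E (X t))
    {n : ℕ} (π : NC n) {k : Fin n} {x : T → A} (hx : Q x) {b : Fin n → A}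
    (hb : ∀ j, k < j → b j ∈ M) :
    Q fun t => partitionMoment E π (Function.update b k (x t)) :=
  momentList_update hM hl hr hE hx hb _ (List.pairwise_lt_finRange n) (List.mem_finRange k)

-- Multilinearity of moments and cumulants

theorem partitionMoment_update_linear [Algebra ℂ A] (hE : IsLinearMap ℂ E) {n : ℕ} (π : NC n)
    (b : Fin n → A) (k : Fin n) :
    IsLinearMap ℂ fun x => partitionMoment E π (Function.update b k x) := by
  refine partitionMoment_update (M := ⊤) (Q := fun X : A → A => IsLinearMap ℂ X)
    (fun _ _ => trivial) ?_ ?_ ?_ π (x := id) ⟨fun _ _ => rfl, fun _ _ => rfl⟩ fun _ _ => trivial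
  · intro c X hX
    exact ⟨fun x y => by rw [hX.map_add, mul_add], fun s x => by rw [hX.map_smul, mul_smul_comm]⟩
  · intro X c _ hX
    exact ⟨fun x y => by rw [hX.map_add, add_mul], fun s x => by rw [hX.map_smul, smul_mul_assoc]⟩
  · intro X hX
    exact ⟨fun x y => by rw [hX.map_add, hE.map_add], fun s x => by rw [hX.map_smul, hE.map_smul]⟩

/-- The partition dependent moment as a multilinear map. -/
def partitionMomentMultilinear [Algebra ℂ A] (hE : IsLinearMap ℂ E) {n : ℕ} (π : NC n) :
    MultilinearMap ℂ (fun _ : Fin n => A) A :=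
  MultilinearMap.mk' (partitionMoment E π)
    (fun b k => (partitionMoment_update_linear hE π b k).map_add)
    (fun b k => (partitionMoment_update_linear hE π b k).map_smul)

/-- The operator-valued cumulant as a multilinear map. -/
def cumulantMultilinear [Algebra ℂ A] (hE : IsLinearMap ℂ E) (n : ℕ) :
    MultilinearMap ℂ (fun _ : Fin n => A) A :=
  ∑ π : NC n, π.moebius • partitionMomentMultilinear hE π

theorem cumulantMultilinear_apply [Algebra ℂ A] (hE : IsLinearMap ℂ E) (n : ℕ) (b : Fin n → A) :
    cumulantMultilinear hE n b = cumulant E b := by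
  simp [cumulantMultilinear, cumulant, partitionMomentMultilinear]

theorem cumulant_fin_one [Algebra ℂ A] (b : Fin 1 → A) : cumulant E b = E (b 0) := by
  have hsub : ∀ π : NC 1, π = NC.one 1 := fun π => Subtype.ext (Setoid.ext fun i j => by
    rw [Subsingleton.elim i j]
    exact ⟨fun _ => trivial, fun _ => π.1.refl j⟩)
  have huniv : (Finset.univ : Finset (NC 1)) = {NC.one 1} :=
    Finset.eq_singleton_iff_unique_mem.2 ⟨Finset.mem_univ _, fun π _ => hsub π⟩
  have hmoment : partitionMoment E (NC.one 1) b = E (b 0) := by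
    rw [partitionMoment, List.finRange_succ, List.finRange_zero, List.map_nil, momentList_cons,
      momentBlock_of_dropWhile_eq_nil List.dropWhile_nil, momentList_nil, mul_one]
  have hmoebius : (NC.one 1).moebius = 1 := by
    classical exact IncidenceAlgebra.mu_self _
  rw [cumulant, huniv, Finset.sum_singleton, hmoment, hmoebius, one_smul]

end Moments

/-! ### Iterated sums -/

section IteratedSums

/-- A function of several variables which in each variable respects the sums `A k = ∑ c k i`,
as soon as the later variables are terms of these sums, gives rise to an iterated sum. -/
theorem hasIteratedSum_of_hasSum_update {ι A M : Type*} [AddCommMonoid M] [TopologicalSpace M]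
    {n : ℕ} (Φ : (Fin n → A) → M) (c : Fin n → ι → A) (s : Fin n → A)
    (h : ∀ (k : Fin n) (b : Fin n → A), (∀ j, k < j → ∃ i, b j = c j i) →
      HasSum (fun i => Φ (Function.update b k (c k i))) (Φ (Function.update b k (s k)))) :
    HasIteratedSum n (fun w => Φ fun j => c j (w j)) (Φ s) := by
  induction n with
  | zero => exact congrArg Φ (Subsingleton.elim _ _)
  | succ n ih =>
    -- The last variable is frozen at a single term while the others are still full sums; the
    -- induction hypothesis expands those.
    refine ⟨fun i => Φ (Fin.snoc (α := fun _ => A) (fun j => s j.castSucc) (c (Fin.last n) i)),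
      fun i => ?_, ?_⟩
    · have := ih (fun b => Φ (Fin.snoc (α := fun _ => A) b (c (Fin.last n) i)))
        (fun j => c j.castSucc) (fun j => s j.castSucc) (fun k b hb => by
          have := h k.castSucc (Fin.snoc (α := fun _ => A) b (c (Fin.last n) i)) (fun j hj => by
            induction j using Fin.lastCases with
            | last => exact ⟨i, by simp⟩
            | cast j =>
              obtain ⟨m, hm⟩ := hb j hj
              exact ⟨m, by simpa using hm⟩)
          simpa only [Fin.snoc_update] using this)
      convert this using 3 with w
      funext j
      induction j using Fin.lastCases with
      | last => simp
      | cast j => simp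
    -- No variable comes after the last one, so its expansion allows arbitrary other arguments, in
    -- particular the full sums `s`.
    · have := h (Fin.last n) s fun j hj => absurd hj (Fin.le_last j).not_gt
      have e : ∀ x, Function.update s (Fin.last n) x =
          Fin.snoc (α := fun _ => A) (fun j => s j.castSucc) x := fun x => by
        funext j
        induction j using Fin.lastCases with
        | last => simp
        | cast j => simp
      simp only [e] at this
      convert this using 2
      rw [← e, Function.update_eq_self]

end IteratedSums

/-! ### Products of paths -/

namespace FreeSemigroupoid

variable {V : Type u} [Quiver.{v} V] {w w' g h k r : FreeSemigroupoid V}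

theorem concat_eq_none (e : h.source ≠ w.range) : w.concat h = none := dif_neg e

theorem exists_concat (e : h.source = w.range) : ∃ g, w.concat h = some g :=
  ⟨_, dif_pos e⟩

theorem source_eq_range (e : w.concat h = some g) : h.source = w.range := by
  by_contra hne
  rw [concat_eq_none hne] at e
  cases e

theorem source_concat (e : w.concat h = some g) : g.source = w.source := by
  have h1 : h.1 = w.2.1 := source_eq_range e
  rw [concat, dif_pos h1, Option.some.injEq] at e
  subst e
  rfl

theorem range_concat (e : w.concat h = some g) : g.range = h.range := by
  have h1 : h.1 = w.2.1 := source_eq_range e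
  rw [concat, dif_pos h1, Option.some.injEq] at e
  subst e
  rfl

theorem length_concat (e : w.concat h = some g) : g.length = w.length + h.length := by
  obtain ⟨a, b, q⟩ := h
  have h1 : a = w.2.1 := source_eq_range e
  subst h1
  rw [concat, dif_pos rfl, Option.some.injEq] at e
  subst e
  exact Quiver.Path.length_comp _ _

/-- Together with `concat_injective` this is two-sided cancellation; it lets the pair of a path and
its image determine the operator `L_w^u`. -/
theorem concat_cancel_right (e : w.concat h = some g) (e' : w'.concat h = some g) : w = w' := by
  have hs := (source_concat e).symm.trans (source_concat e')
  obtain ⟨x, y, p⟩ := w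
  obtain ⟨x', y', p'⟩ := w'
  obtain ⟨a, b, q⟩ := h
  have h1 : a = y := source_eq_range e
  have h2 : a = y' := source_eq_range e'
  change x = x' at hs
  subst h1 h2 hs
  rw [concat, dif_pos rfl, Option.some.injEq] at e e'
  rw [← e] at e'
  simp only [Quiver.Path.cast_rfl_rfl, Sigma.mk.injEq, heq_eq_eq, true_and,
    Quiver.Path.comp_inj_left] at e'
  rw [e']

theorem concat_assoc (e : w.concat h = some g) (e' : h.concat k = some r) :
    g.concat k = w.concat r := by
  obtain ⟨x, y, p⟩ := w
  obtain ⟨a, b, q⟩ := h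
  obtain ⟨c, d, s⟩ := k
  have h1 : a = y := source_eq_range e
  have h2 : c = b := source_eq_range e'
  subst h1 h2
  rw [concat, dif_pos rfl, Option.some.injEq] at e e'
  subst e e'
  simp [concat, Quiver.Path.comp_assoc]

theorem vertex_concat (w : FreeSemigroupoid V) : (vertex w.source).concat w = some w := by
  obtain ⟨x, y, p⟩ := w
  simp [concat, vertex, source]

theorem vertex_concat_eq_some {x : V} (e : (vertex x).concat h = some g) : g = h := by
  have hx : h.source = x := source_eq_range e
  subst hx
  rw [vertex_concat, Option.some.injEq] at e
  exact e.symm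

theorem eq_vertex_of_length_eq_zero (h : w.length = 0) : w = vertex w.source := by
  obtain ⟨x, y, p⟩ := w
  cases p with
  | nil => rfl
  | cons p e => cases h

end FreeSemigroupoid

/-! ### Action on basis vectors -/

section Operators

open FreeSemigroupoid

variable {V : Type u} [Quiver.{v} V]

theorem inner_basisVec_left (w : FreeSemigroupoid V) (f : GraphHilbert V) :
    ⟪basisVec w, f⟫_ℂ = f w := by
  simp [basisVec, lp.inner_single_left]

open Classical in
theorem basisVec_apply (w g : FreeSemigroupoid V) :
    (basisVec w : GraphHilbert V) g = if g = w then 1 else 0 := by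
  rw [basisVec, lp.single_apply, Pi.single_apply]

theorem basisVec_apply_self (w : FreeSemigroupoid V) : (basisVec w : GraphHilbert V) w = 1 := by
  simp [basisVec_apply]

theorem basisVec_ne_zero (w : FreeSemigroupoid V) : basisVec w ≠ 0 := fun h => by
  have := basisVec_apply_self w
  rw [h] at this
  simp at this

theorem basisVec_injective : Function.Injective (basisVec : FreeSemigroupoid V → _) :=
  fun w g h => by
    have := basisVec_apply_self w
    rw [h, basisVec_apply] at this
    by_contra hne
    simp [hne] at this

theorem hasSum_smul_basisVec (f : GraphHilbert V) : HasSum (fun g => f g • basisVec g) f := by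
  classical
  refine (lp.hasSum_single (p := 2) (by norm_num) f).congr_fun fun g => ?_
  ext h
  rw [lp.coeFn_smul, Pi.smul_apply, basisVec_apply, lp.single_apply, Pi.single_apply]
  split_ifs with e
  · subst e
    simp
  · simp

theorem ext_basisVec {a b : GraphOp V} (h : ∀ w, a (basisVec w) = b (basisVec w)) : a = b := by
  ext1 f
  have ha := (hasSum_smul_basisVec f).mapL a
  have hb := (hasSum_smul_basisVec f).mapL b
  simp only [map_smul, h] at ha hb
  exact ha.unique hb

theorem creation_of_concat {w h g : FreeSemigroupoid V} (e : w.concat h = some g) :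
    creation w (basisVec h) = basisVec g := by
  rw [creation_basisVec, e]
  rfl

theorem creation_of_ne {w h : FreeSemigroupoid V} (e : h.source ≠ w.range) :
    creation w (basisVec h) = 0 := by
  rw [creation_basisVec, concat_eq_none e]
  rfl

theorem annihilation_apply (w h : FreeSemigroupoid V) (f : GraphHilbert V) :
    annihilation w f h = (w.concat h).elim 0 f := rfl

theorem annihilation_of_concat {w h g : FreeSemigroupoid V} (e : w.concat h = some g) :
    annihilation w (basisVec g) = basisVec h := by
  classical
  ext k
  rw [annihilation_apply, basisVec_apply]
  split_ifs with hk
  · rw [hk, e]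
    exact basisVec_apply_self g
  · rcases hr : w.concat k with _ | r
    · rfl
    · rw [Option.elim_some, basisVec_apply, if_neg]
      rintro rfl
      exact hk (w.concat_injective _ _ _ hr e)

theorem annihilation_of_forall_ne {w g : FreeSemigroupoid V} (e : ∀ h, w.concat h ≠ some g) :
    annihilation w (basisVec g) = 0 := by
  classical
  ext k
  rw [annihilation_apply]
  rcases hr : w.concat k with _ | r
  · rfl
  · rw [Option.elim_some, basisVec_apply, if_neg]
    · rfl
    · rintro rfl
      exact e k hr

open Classical in
theorem vertexProj_basisVec (x : V) (h : FreeSemigroupoid V) :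
    vertexProj x (basisVec h) = if h.source = x then basisVec h else 0 := by
  split_ifs with e
  · subst e
    exact creation_of_concat (vertex_concat h)
  · exact creation_of_ne e

open Classical in
theorem vertexProj_mul_vertexProj (x y : V) :
    vertexProj x * vertexProj y = if x = y then vertexProj x else 0 := by
  refine ext_basisVec fun h => ?_
  rw [mul_apply_eq_comp, vertexProj_basisVec]
  split_ifs with h1 h2 h2
  · rfl
  · rw [vertexProj_basisVec, if_neg fun h3 => h2 (h3.symm.trans h1)]
    rfl
  · rw [map_zero, vertexProj_basisVec, if_neg fun h3 => h1 (h3.trans h2)]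
  · rw [map_zero]
    rfl

open Classical in
theorem vertexProj_mul_creation (x : V) (w : FreeSemigroupoid V) :
    vertexProj x * creation w = if w.source = x then creation w else 0 := by
  refine ext_basisVec fun h => ?_
  rw [mul_apply_eq_comp]
  by_cases hr : h.source = w.range
  · obtain ⟨g, e⟩ := exists_concat hr
    rw [creation_of_concat e, vertexProj_basisVec, source_concat e]
    split_ifs
    · rw [creation_of_concat e]
    · rfl
  · rw [creation_of_ne hr, map_zero]
    split_ifs
    · rw [creation_of_ne hr]
    · rfl

open Classical in
theorem creation_mul_vertexProj (x : V) (w : FreeSemigroupoid V) :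
    creation w * vertexProj x = if w.range = x then creation w else 0 := by
  refine ext_basisVec fun h => ?_
  rw [mul_apply_eq_comp, vertexProj_basisVec]
  split_ifs with h1 h2 h2
  · rfl
  · rw [creation_of_ne fun e => h2 (e.symm.trans h1)]
    rfl
  · rw [map_zero, creation_of_ne fun e => h1 (e.trans h2)]
  · rw [map_zero]
    rfl

open Classical in
theorem annihilation_mul_vertexProj (x : V) (w : FreeSemigroupoid V) :
    annihilation w * vertexProj x = if w.source = x then annihilation w else 0 := by
  refine ext_basisVec fun h => ?_
  rw [mul_apply_eq_comp, vertexProj_basisVec]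
  have key : h.source ≠ w.source → annihilation w (basisVec h) = 0 := fun hne =>
    annihilation_of_forall_ne fun k e => hne (source_concat e)
  split_ifs with h1 h2 h2
  · rfl
  · rw [key fun e => h2 (e.symm.trans h1)]
    rfl
  · rw [map_zero, key fun e => h1 (e.trans h2)]
  · rw [map_zero]
    rfl

open Classical in
theorem vertexProj_mul_annihilation (x : V) (w : FreeSemigroupoid V) :
    vertexProj x * annihilation w = if w.range = x then annihilation w else 0 := by
  refine ext_basisVec fun g => ?_
  rw [mul_apply_eq_comp]
  by_cases h : ∃ h, w.concat h = some g
  · obtain ⟨h, e⟩ := h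
    rw [annihilation_of_concat e, vertexProj_basisVec, source_eq_range e]
    split_ifs
    · rw [annihilation_of_concat e]
    · rfl
  · push Not at h
    rw [annihilation_of_forall_ne h, map_zero]
    split_ifs
    · rw [annihilation_of_forall_ne h]
    · rfl

open Classical in
/-- The compression of `L_w^u` to a vertex is nonzero only if `w` is a loop at this vertex or the
vertex itself. -/
theorem vertexProj_mul_op_mul_vertexProj (x : V) (i : FourierIndex V) :
    vertexProj x * i.op * vertexProj x =
      if i.path.source = x ∧ i.path.range = x then i.op else 0 := by
  obtain ⟨⟨w, u⟩, hi⟩ := i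
  cases u
  · change vertexProj x * creation w * vertexProj x =
      if w.source = x ∧ w.range = x then creation w else 0
    rw [vertexProj_mul_creation]
    split_ifs with h1 h2 h2
    · rw [creation_mul_vertexProj, if_pos h2.2]
    · rw [creation_mul_vertexProj, if_neg fun h => h2 ⟨h1, h⟩]
    · exact absurd h2.1 h1
    · rw [zero_mul]
  · change vertexProj x * annihilation w * vertexProj x =
      if w.source = x ∧ w.range = x then annihilation w else 0
    rw [vertexProj_mul_annihilation]
    split_ifs with h1 h2 h2
    · rw [annihilation_mul_vertexProj, if_pos h2.1]
    · rw [annihilation_mul_vertexProj, if_neg fun h => h2 ⟨h, h1⟩]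
    · exact absurd h2.2 h1
    · rw [zero_mul]

theorem vertexProj_mul_diagonalCompression_of_mem {S : Finset V} {x : V} (hx : x ∈ S)
    (a : GraphOp V) :
    vertexProj x * diagonalCompression S a = vertexProj x * a * vertexProj x := by
  classical
  rw [diagonalCompression, Finset.mul_sum, Finset.sum_eq_single_of_mem x hx]
  · rw [← mul_assoc, ← mul_assoc, vertexProj_mul_vertexProj, if_pos rfl]
  · intro y _ hy
    rw [← mul_assoc, ← mul_assoc, vertexProj_mul_vertexProj, if_neg hy.symm, zero_mul, zero_mul]

theorem vertexProj_mul_diagonalCompression_of_notMem {S : Finset V} {x : V} (hx : x ∉ S)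
    (a : GraphOp V) : vertexProj x * diagonalCompression S a = 0 := by
  classical
  rw [diagonalCompression, Finset.mul_sum]
  refine Finset.sum_eq_zero fun y hy => ?_
  rw [← mul_assoc, ← mul_assoc, vertexProj_mul_vertexProj, if_neg, zero_mul, zero_mul]
  rintro rfl
  exact hx hy

/-! ### The conditional expectation -/

/-- The vacuum coefficient `⟨ξ_x, a ξ_x⟩`. -/
def vacuumCoeff (x : V) (a : GraphOp V) : ℂ :=
  ⟪basisVec (vertex x), a (basisVec (vertex x))⟫_ℂ

theorem condExp_basisVec (a : GraphOp V) (h : FreeSemigroupoid V) :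
    condExp a (basisVec h) = vacuumCoeff h.source a • basisVec h := by
  classical
  ext g
  change vacuumCoeff g.source a * basisVec h g = vacuumCoeff h.source a * basisVec h g
  rw [basisVec_apply]
  split_ifs with e
  · rw [e]
  · rw [mul_zero, mul_zero]

theorem vacuumCoeff_condExp_mul (x : V) (a b : GraphOp V) :
    vacuumCoeff x (condExp a * b) = vacuumCoeff x a * vacuumCoeff x b := by
  rw [vacuumCoeff, vacuumCoeff, vacuumCoeff, inner_basisVec_left, inner_basisVec_left _ (b _)]
  rfl

theorem condExp_isLinearMap : IsLinearMap ℂ (condExp : GraphOp V → GraphOp V) where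
  map_add a b := ext_basisVec fun h => by
    rw [add_apply, condExp_basisVec, condExp_basisVec, condExp_basisVec,
      ← add_smul]
    congr 1
    simp [vacuumCoeff]
  map_smul c a := ext_basisVec fun h => by
    rw [smul_apply, condExp_basisVec, condExp_basisVec, smul_smul]
    congr 1
    simp [vacuumCoeff]

theorem condExp_zero : condExp (0 : GraphOp V) = 0 := condExp_isLinearMap.map_zero

theorem condExp_sum {κ : Type*} (s : Finset κ) (f : κ → GraphOp V) :
    condExp (∑ i ∈ s, f i) = ∑ i ∈ s, condExp (f i) :=
  map_sum (condExp_isLinearMap.mk' _) f s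

theorem condExp_one : condExp (1 : GraphOp V) = 1 := ext_basisVec fun h => by
  rw [condExp_basisVec, vacuumCoeff, inner_basisVec_left]
  simp [basisVec_apply_self]

theorem condExp_condExp_mul (a b : GraphOp V) :
    condExp (condExp a * b) = condExp a * condExp b := ext_basisVec fun h => by
  rw [mul_apply_eq_comp, condExp_basisVec, condExp_basisVec, map_smul,
    condExp_basisVec, vacuumCoeff_condExp_mul, smul_smul, mul_comm]

/-- A vertex projection is its own conditional expectation, so this is a case of the module
property. -/
theorem condExp_vertexProj_mul (x : V) (a : GraphOp V) :
    condExp (vertexProj x * a) = vertexProj x * condExp a := by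
  have e : vertexProj x = condExp (vertexProj x) := ext_basisVec fun h => by
    classical
    rw [condExp_basisVec, vacuumCoeff, vertexProj_basisVec, vertexProj_basisVec]
    change _ = ⟪_, if h.source = x then _ else _⟫_ℂ • _
    split_ifs
    · rw [inner_basisVec_left, basisVec_apply_self, one_smul]
    · rw [inner_zero_right, zero_smul]
  rw [e, condExp_condExp_mul, ← e]

theorem condExp_compression (x : V) (a : GraphOp V) :
    condExp (vertexProj x * a * vertexProj x) = vacuumCoeff x a • vertexProj x := by
  classical
  refine ext_basisVec fun h => ?_
  rw [mul_assoc, condExp_vertexProj_mul, mul_apply_eq_comp, condExp_basisVec, map_smul,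
    smul_apply, vertexProj_basisVec]
  split_ifs with e
  · subst e
    rw [vacuumCoeff, mul_apply_eq_comp, vertexProj_basisVec, if_pos (by rfl), vacuumCoeff]
  · rw [smul_zero, smul_zero]

/-- An element of `D_G` that lives on a finite set of vertices is a combination of the vertex
projections. -/
theorem eq_sum_smul_vertexProj {a : GraphOp V} (ha : condExp a = a) (S : Finset V)
    (hS : ∀ x ∉ S, vertexProj x * a = 0) :
    a = ∑ x ∈ S, vacuumCoeff x a • vertexProj x := by
  classical
  refine ext_basisVec fun h => ?_
  simp only [sum_apply, smul_apply, vertexProj_basisVec,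
    smul_ite, smul_zero, Finset.sum_ite_eq]
  have e : a (basisVec h) = vacuumCoeff h.source a • basisVec h := by
    rw [← condExp_basisVec, ha]
  split_ifs with hs
  · exact e
  · have := congrArg (fun b : GraphOp V => b (basisVec h)) (hS _ hs)
    simpa [e, vertexProj_basisVec] using this

/-! ### The diagonal subalgebra -/

/-- The diagonal operators are constant on the paths with a given source. -/
theorem diagonalSubalgebra_basisVec {d : GraphOp V} (hd : d ∈ diagonalSubalgebra V)
    (h : FreeSemigroupoid V) : d (basisVec h) = vacuumCoeff h.source d • basisVec h := by
  have hcont : ∀ g k : FreeSemigroupoid V, Continuous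
      fun A : GraphHilbert V →WOT[ℂ] GraphHilbert V => ⟪basisVec g, A (basisVec k)⟫_ℂ :=
    fun g k => ContinuousLinearMapWOT.continuous_dual_apply (basisVec k) (innerSL ℂ (basisVec g))
  -- Stated through matrix entries, the property is closed in the weak operator topology, so it
  -- passes from the algebra to its closure.
  have hclosed : IsClosed {A : GraphHilbert V →WOT[ℂ] GraphHilbert V | ∀ g k : FreeSemigroupoid V,
      ⟪basisVec g, A (basisVec k)⟫_ℂ =
        ⟪basisVec (vertex k.source), A (basisVec (vertex k.source))⟫_ℂ *
          ⟪basisVec g, (basisVec k : GraphHilbert V)⟫_ℂ} := by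
    simp only [Set.ofPred_forall]
    exact isClosed_iInter fun g => isClosed_iInter fun k =>
      isClosed_eq (hcont g k) ((hcont _ _).mul continuous_const)
  have hsub : ContinuousLinearMapWOT.ofCLM '' (StarAlgebra.adjoin ℂ (Set.range (vertexProj (V := V))) :
      Set (GraphOp V)) ⊆ {A | ∀ g k : FreeSemigroupoid V,
      ⟪basisVec g, A (basisVec k)⟫_ℂ =
        ⟪basisVec (vertex k.source), A (basisVec (vertex k.source))⟫_ℂ *
          ⟪basisVec g, (basisVec k : GraphHilbert V)⟫_ℂ} := by
    classical
    rintro _ ⟨b, hb, rfl⟩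
    -- On the algebra an unspecified function `q` suits induction better; evaluation at a vertex
    -- identifies it with the vacuum coefficients.
    suffices H : ∃ q : V → ℂ, ∀ k, b (basisVec k) = q k.source • basisVec k by
      obtain ⟨q, hq⟩ := H
      intro g k
      change ⟪basisVec g, b (basisVec k)⟫_ℂ =
        ⟪basisVec (vertex k.source), b (basisVec (vertex k.source))⟫_ℂ * _
      rw [hq, hq, inner_smul_right, inner_smul_right, inner_basisVec_left (vertex _),
        basisVec_apply_self, mul_one]
      rfl
    induction hb using StarAlgebra.adjoin_induction with
    | mem b hb =>
      obtain ⟨x, rfl⟩ := hb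
      refine ⟨fun y => if y = x then 1 else 0, fun k => ?_⟩
      rw [vertexProj_basisVec]
      split_ifs with e <;> simp [e]
    | algebraMap c => exact ⟨fun _ => c, fun k => rfl⟩
    | add a b _ _ iha ihb =>
      obtain ⟨p, hp⟩ := iha
      obtain ⟨q, hq⟩ := ihb
      exact ⟨fun x => p x + q x, fun k => by
        rw [add_apply, hp, hq, add_smul]⟩
    | mul a b _ _ iha ihb =>
      obtain ⟨p, hp⟩ := iha
      obtain ⟨q, hq⟩ := ihb
      exact ⟨fun x => q x * p x, fun k => by
        rw [mul_apply_eq_comp, hq, map_smul, hp, smul_smul]⟩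
    | star a _ iha =>
      obtain ⟨p, hp⟩ := iha
      refine ⟨fun x => starRingEnd ℂ (p x), fun k => ?_⟩
      ext g
      rw [← inner_basisVec_left, ContinuousLinearMap.star_eq_adjoint,
        ContinuousLinearMap.adjoint_inner_right, hp, inner_smul_left, inner_basisVec_left,
        lp.coeFn_smul, Pi.smul_apply, basisVec_apply, smul_eq_mul]
      split_ifs with e
      · rw [e]
      · rw [mul_zero, mul_zero]
  have := closure_minimal hsub hclosed hd
  ext g
  rw [← inner_basisVec_left, lp.coeFn_smul, Pi.smul_apply, ← inner_basisVec_left g (basisVec h)]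
  exact this g h

theorem diagonalSubalgebra_mul_vertexProj {d : GraphOp V} (hd : d ∈ diagonalSubalgebra V) (x : V) :
    d * vertexProj x = vacuumCoeff x d • vertexProj x := by
  classical
  refine ext_basisVec fun h => ?_
  rw [mul_apply_eq_comp, smul_apply, vertexProj_basisVec]
  split_ifs with e
  · rw [diagonalSubalgebra_basisVec hd, e]
  · rw [map_zero, smul_zero]

theorem diagonalSubalgebra_mul_diagonalCompression {d : GraphOp V} (hd : d ∈ diagonalSubalgebra V)
    (S : Finset V) (a : GraphOp V) :
    d * diagonalCompression S a =
      ∑ x ∈ S, vacuumCoeff x d • (vertexProj x * diagonalCompression S a) := by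
  conv_lhs => rw [diagonalCompression, Finset.mul_sum]
  refine Finset.sum_congr rfl fun x hx => ?_
  rw [vertexProj_mul_diagonalCompression_of_mem hx, ← mul_assoc, ← mul_assoc,
    diagonalSubalgebra_mul_vertexProj hd, smul_mul_assoc, smul_mul_assoc]

end Operators

/-! ### Monomials -/

section Monomials

open FreeSemigroupoid

variable {V : Type u} [Quiver.{v} V]

/-- The operators that map every basis vector to a multiple of a basis vector. -/
def columnMonomials (V : Type u) [Quiver.{v} V] : Submonoid (GraphOp V) where
  carrier := {X | ∀ h, ∃ (c : ℂ) (g : FreeSemigroupoid V), X (basisVec h) = c • basisVec g}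
  one_mem' h := ⟨1, h, by simp⟩
  mul_mem' {X Y} hX hY h := by
    obtain ⟨c, g, e⟩ := hY h
    obtain ⟨c', g', e'⟩ := hX g
    exact ⟨c * c', g', by rw [mul_apply_eq_comp, e, map_smul, e', smul_smul]⟩

theorem condExp_mem_columnMonomials (X : GraphOp V) : condExp X ∈ columnMonomials V :=
  fun h => ⟨_, h, condExp_basisVec X h⟩

/-- The operators that act on the basis by a partially defined map of paths which commutes with
right multiplication and, unless the operator is the identity, is defined only on paths with one
particular source. -/
def pathMonomials (V : Type u) [Quiver.{v} V] : Submonoid (GraphOp V) where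
  carrier := {X | (∀ h, X (basisVec h) = 0 ∨ ∃ g, X (basisVec h) = basisVec g ∧
      ∀ k r, h.concat k = some r → ∃ s, g.concat k = some s ∧ X (basisVec r) = basisVec s) ∧
    (X = 1 ∨ ∀ h h', X (basisVec h) ≠ 0 → X (basisVec h') ≠ 0 → h.source = h'.source)}
  one_mem' := ⟨fun h => .inr ⟨h, rfl, fun k r e => ⟨r, e, rfl⟩⟩, .inl rfl⟩
  mul_mem' := by
    rintro X Y ⟨hX, hX'⟩ ⟨hY, hY'⟩
    refine ⟨fun h => ?_, ?_⟩
    · rw [mul_apply_eq_comp]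
      rcases hY h with e | ⟨g, e, H⟩
      · exact .inl (by rw [e, map_zero])
      · rw [e]
        refine (hX g).imp_right ?_
        rintro ⟨g', e', H'⟩
        refine ⟨g', e', fun k r er => ?_⟩
        obtain ⟨s, es, es'⟩ := H k r er
        obtain ⟨s', et, et'⟩ := H' k s es
        exact ⟨s', et, by rw [mul_apply_eq_comp, es', et']⟩
    · rcases hY' with rfl | hY'
      · simpa using hX'
      · refine .inr fun h h' e e' => hY' h h' (fun e0 => e ?_) fun e0 => e' ?_
        · rw [mul_apply_eq_comp, e0, map_zero]
        · rw [mul_apply_eq_comp, e0, map_zero]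

theorem zero_mem_pathMonomials : (0 : GraphOp V) ∈ pathMonomials V :=
  ⟨fun _ => .inl rfl, .inr fun _ _ h => absurd rfl h⟩

/-- If `X` is not the identity and some vacuum coefficient at `x` is nonzero, then `X ξ_x = ξ_x`.
Compatibility with right multiplication makes `X` fix all paths with source `x`, and the condition
on sources makes it kill the others, so it acts as `L_x`. -/
theorem condExp_eq_self_of_mem_pathMonomials {X : GraphOp V} (hX : X ∈ pathMonomials V)
    (hne : condExp X ≠ 0) : condExp X = X := by
  classical
  obtain ⟨h1, rfl | h2⟩ := hX
  · exact condExp_one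
  have : ∃ x, vacuumCoeff x X ≠ 0 := by
    by_contra! H
    exact hne (ext_basisVec fun h => by rw [condExp_basisVec, H, zero_smul]; rfl)
  obtain ⟨x, hx⟩ := this
  have hx0 : X (basisVec (vertex x)) ≠ 0 := fun e => hx (by rw [vacuumCoeff, e, inner_zero_right])
  obtain ⟨g, e, H⟩ := (h1 (vertex x)).resolve_left hx0
  have hg : g = vertex x := by
    by_contra hg
    refine hx ?_
    rw [vacuumCoeff, e, inner_basisVec_left, basisVec_apply, if_neg fun h => hg h.symm]
  subst hg
  refine ext_basisVec fun h => ?_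
  rw [condExp_basisVec]
  by_cases hs : h.source = x
  · subst hs
    obtain ⟨s, es, es'⟩ := H h h (vertex_concat h)
    obtain rfl := vertex_concat_eq_some es
    rw [es', vacuumCoeff, e, inner_basisVec_left, basisVec_apply_self, one_smul]
  · have h0 : X (basisVec h) = 0 := by
      by_contra hne
      exact hs (h2 _ _ hne hx0)
    have h0' : X (basisVec (vertex h.source)) = 0 := by
      by_contra hne
      exact hs (h2 _ _ hne hx0)
    rw [h0, vacuumCoeff, h0', inner_zero_right, zero_smul]

theorem creation_mem_pathMonomials (w : FreeSemigroupoid V) : creation w ∈ pathMonomials V := by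
  refine ⟨fun h => ?_, .inr fun h h' e e' => ?_⟩
  · by_cases hr : h.source = w.range
    · obtain ⟨g, e⟩ := exists_concat hr
      refine .inr ⟨g, creation_of_concat e, fun k r er => ?_⟩
      obtain ⟨s, es⟩ := exists_concat ((source_concat er).trans hr)
      exact ⟨s, by rw [concat_assoc e er, es], creation_of_concat es⟩
    · exact .inl (creation_of_ne hr)
  · by_contra hne
    by_cases hr : h.source = w.range
    · exact e' (creation_of_ne fun h2 => hne (hr.trans h2.symm))
    · exact e (creation_of_ne hr)

theorem annihilation_mem_pathMonomials (w : FreeSemigroupoid V) :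
    annihilation w ∈ pathMonomials V := by
  have key : ∀ g, annihilation w (basisVec g) ≠ 0 → ∃ h, w.concat h = some g := fun g hne => by
    by_contra! H
    exact hne (annihilation_of_forall_ne H)
  refine ⟨fun g => ?_, .inr fun g g' e e' => ?_⟩
  · by_cases h0 : annihilation w (basisVec g) = 0
    · exact .inl h0
    · obtain ⟨h, e⟩ := key g h0
      refine .inr ⟨h, annihilation_of_concat e, fun k r er => ?_⟩
      obtain ⟨s, es⟩ := exists_concat ((source_eq_range er).trans (range_concat e))
      exact ⟨s, es, annihilation_of_concat (by rw [← concat_assoc e es, er])⟩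
  · obtain ⟨h, e⟩ := key g e
    obtain ⟨h', e'⟩ := key g' e'
    rw [source_concat e, source_concat e']

theorem op_mem_pathMonomials (i : FourierIndex V) : i.op ∈ pathMonomials V := by
  obtain ⟨⟨w, u⟩, hi⟩ := i
  cases u
  · exact creation_mem_pathMonomials w
  · exact annihilation_mem_pathMonomials w

theorem smul_op_mem_columnMonomials (c : ℂ) (i : FourierIndex V) :
    c • i.op ∈ columnMonomials V := fun h => by
  rcases (op_mem_pathMonomials i).1 h with e | ⟨g, e, _⟩
  · exact ⟨0, h, by rw [smul_apply, e, smul_zero, zero_smul]⟩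
  · exact ⟨c, g, by rw [smul_apply, e]⟩

/-- The number `μ` times the moment is the cumulant of the operators `L_w^u`. -/
theorem moebiusNumber_smul_condExp_prod {n : ℕ} (w : Fin n → FourierIndex V) :
    moebiusNumber w • condExp (List.ofFn fun j => (w j).op).prod =
      cumulant condExp fun j => (w j).op := by
  classical
  rw [moebiusNumber, cumulant, Finset.sum_smul]
  refine Finset.sum_subset_zero_on_sdiff (Finset.subset_univ _) ?_ ?_
  · intro π hπ
    have : partitionMoment condExp π (fun j => (w j).op) = 0 := by
      simpa [connectedPartitions] using hπ
    rw [this, smul_zero]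
  · intro π hπ
    have hne : partitionMoment condExp π (fun j => (w j).op) ≠ 0 := by
      simpa [connectedPartitions] using hπ
    -- The nonzero moment equals the product and is itself fixed by `E`, so it is also `E` of the
    -- product.
    have := momentList_eq_prod zero_mem_pathMonomials
      (fun x hx => condExp_eq_self_of_mem_pathMonomials hx) (List.finRange n)
      (fun j _ => op_mem_pathMonomials (w j)) hne
    rw [List.ofFn_eq_map, ← this, map_momentList condExp_one condExp_condExp_mul]
    rfl

end Monomials

/-! ### Fourier expansions -/

section Fourier

open FreeSemigroupoid

variable {V : Type u} [Quiver.{v} V]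

/-- Different operators `L_w^u` do not map a basis vector to the same basis vector. -/
theorem FourierIndex.eq_of_op_basisVec {i j : FourierIndex V} {h g : FreeSemigroupoid V}
    (hi : i.op (basisVec h) = basisVec g) (hj : j.op (basisVec h) = basisVec g) : i = j := by
  have hc : ∀ w, creation w (basisVec h) = basisVec g → w.concat h = some g := fun w e => by
    by_cases hr : h.source = w.range
    · obtain ⟨k, hk⟩ := exists_concat hr
      rw [creation_of_concat hk] at e
      rwa [← basisVec_injective e]
    · rw [creation_of_ne hr] at e
      exact absurd e.symm (basisVec_ne_zero g)
  have ha : ∀ w, annihilation w (basisVec h) = basisVec g → w.concat g = some h := fun w e => by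
    by_cases hr : ∃ k, w.concat k = some h
    · obtain ⟨k, hk⟩ := hr
      rw [annihilation_of_concat hk] at e
      rwa [← basisVec_injective e]
    · push Not at hr
      rw [annihilation_of_forall_ne hr] at e
      exact absurd e.symm (basisVec_ne_zero g)
  obtain ⟨⟨w, u⟩, hu⟩ := i
  obtain ⟨⟨w', u'⟩, hu'⟩ := j
  cases u <;> cases u'
  · obtain rfl := concat_cancel_right (hc w hi) (hc w' hj)
    rfl
  -- A creation operator never shortens a path, whereas an exponent `*` forces positive length and
  -- hence strict shortening.
  · have h1 := length_concat (hc w hi)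
    have h2 := length_concat (ha w' hj)
    have h3 : 0 < w'.length := hu' rfl
    omega
  · have h1 := length_concat (ha w hi)
    have h2 := length_concat (hc w' hj)
    have h3 : 0 < w.length := hu rfl
    omega
  · obtain rfl := concat_cancel_right (ha w hi) (ha w' hj)
    rfl

/-- On basis vectors the Fourier series converges in norm. -/
theorem HasFourierExpansion.hasSum_basisVec {a : GraphOp V} (ha : HasFourierExpansion a)
    (h : FreeSemigroupoid V) :
    HasSum (fun i : FourierIndex V => graphFourierCoeff a i • i.op (basisVec h))
      (a (basisVec h)) := by
  classical
  -- The indices that do not kill `ξ_h` are mapped injectively by `γ` to basis vectors. Along `γ`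
  -- the Fourier series is a reindexing of the basis expansion of `a ξ_h`, whose coordinates outside
  -- the range of `γ` vanish.
  let I : Set (FourierIndex V) := {i | i.op (basisVec h) ≠ 0}
  have hI : ∀ i : I, ∃ g, (i : FourierIndex V).op (basisVec h) = basisVec g := fun i =>
    ((op_mem_pathMonomials i.1).1 h).elim (fun e => absurd e i.2) fun ⟨g, e, _⟩ => ⟨g, e⟩
  choose γ hγ using hI
  have hγi : Function.Injective γ := fun i j e =>
    Subtype.ext (FourierIndex.eq_of_op_basisVec (hγ i) (by rw [hγ j, e]))
  have hterm : ∀ g (i : FourierIndex V), ⟪basisVec g, i.op (basisVec h)⟫_ℂ ≠ 0 →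
      i.op (basisVec h) = basisVec g := fun g i hne => by
    have hi : i ∈ I := fun e => hne (by rw [e, inner_zero_right])
    rw [hγ ⟨i, hi⟩, inner_basisVec_left, basisVec_apply] at hne
    rw [hγ ⟨i, hi⟩]
    by_contra hg
    exact hne (if_neg fun e => hg (by rw [e]))
  have hmem : ∀ i : I, a (basisVec h) (γ i) = graphFourierCoeff a i := fun i => by
    rw [← inner_basisVec_left]
    refine (ha (γ i) h).unique ?_
    have e1 : graphFourierCoeff a i = graphFourierCoeff a i *
        ⟪basisVec (γ i), (i : FourierIndex V).op (basisVec h)⟫_ℂ := by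
      rw [hγ, inner_basisVec_left, basisVec_apply_self, mul_one]
    rw [e1]
    refine hasSum_single (i : FourierIndex V) fun j hj => ?_
    by_contra hne
    exact hj (FourierIndex.eq_of_op_basisVec (hterm _ _ (right_ne_zero_of_mul hne)) (hγ i))
  have hout : ∀ g ∉ Set.range γ, a (basisVec h) g = 0 := fun g hg => by
    rw [← inner_basisVec_left]
    refine (ha g h).unique ?_
    convert hasSum_zero with i
    by_contra hne
    have e := hterm _ _ (right_ne_zero_of_mul hne)
    have hi : i ∈ I := fun e0 => basisVec_ne_zero g (by rw [← e, e0])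
    exact hg ⟨⟨i, hi⟩, basisVec_injective (by rw [← hγ, e])⟩
  have hsum := (hγi.hasSum_iff fun g hg => by rw [hout g hg, zero_smul]).2
    (hasSum_smul_basisVec (a (basisVec h)))
  refine (hasSum_subtype_iff_of_support_subset (s := I) fun i hi e => hi ?_).1 ?_
  · rw [e, smul_zero]
  · convert hsum using 1
    funext i
    change graphFourierCoeff a i • (i : FourierIndex V).op (basisVec h) =
      a (basisVec h) (γ i) • basisVec (γ i)
    rw [hmem, hγ]

theorem path_of_mem_compressedIndices {S : Finset V} {a : GraphOp V} {i : FourierIndex V}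
    (hi : i ∈ compressedIndices S a) : i.path.source ∈ S ∧ i.path.range = i.path.source := by
  rcases hi with hi | ⟨y, hy, e⟩
  · obtain ⟨y, hy, hl⟩ := Set.mem_iUnion₂.1 hi
    exact ⟨by rw [hl.2.2.1]; exact hy, hl.2.2.2.trans hl.2.2.1.symm⟩
  · rw [← e]
    exact ⟨hy.1, rfl⟩

/-- Here `L_w^u = L_y L_w^u L_y` for the base point `y ∈ S` of `w`. Single Fourier terms thus
satisfy the support hypothesis of `cumulant_eq_sum_vertexProj`. -/
theorem vertexProj_mul_op_eq_zero {S : Finset V} {a : GraphOp V} {i : FourierIndex V}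
    (hi : i ∈ compressedIndices S a) {x : V} (hx : x ∉ S) : vertexProj x * i.op = 0 := by
  classical
  obtain ⟨h1, h2⟩ := path_of_mem_compressedIndices hi
  have := vertexProj_mul_op_mul_vertexProj i.path.source i
  rw [if_pos ⟨rfl, h2⟩] at this
  rw [← this, ← mul_assoc, ← mul_assoc, vertexProj_mul_vertexProj, if_neg, zero_mul, zero_mul]
  rintro rfl
  exact hx h1

open Classical in
/-- The Fourier series of a compression of `a` to a vertex. -/
theorem HasFourierExpansion.hasSum_compression {a : GraphOp V} (ha : HasFourierExpansion a)
    (S : Finset V) (x : V) (h : FreeSemigroupoid V) :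
    HasSum (fun i : compressedIndices S a => ((graphFourierCoeff a i *
        if x = (i : FourierIndex V).path.source then 1 else 0) •
          (i : FourierIndex V).op) (basisVec h))
      ((vertexProj x * diagonalCompression S a) (basisVec h)) := by
  by_cases hx : x ∈ S
  · rw [vertexProj_mul_diagonalCompression_of_mem hx]
    have hsum : HasSum (fun i : FourierIndex V => (graphFourierCoeff a i •
        (vertexProj x * i.op * vertexProj x)) (basisVec h))
        ((vertexProj x * a * vertexProj x) (basisVec h)) := by
      simp only [smul_apply, mul_apply_eq_comp, vertexProj_basisVec]
      split_ifs
      · simpa only [map_smul] using (ha.hasSum_basisVec h).mapL (vertexProj x)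
      · simpa only [map_zero, smul_zero] using hasSum_zero
    -- A term that survives compression to `x` has a nonzero coefficient and a path that is a loop
    -- at `x` or `x` itself, so its index is admitted.
    have hout : ∀ i ∉ compressedIndices S a,
        graphFourierCoeff a i • (vertexProj x * i.op * vertexProj x) = 0 := fun i hi => by
      rw [vertexProj_mul_op_mul_vertexProj]
      split_ifs with hp
      · by_contra hne
        have hs : i.path ∈ fourierSupport a := ⟨i, rfl, (smul_ne_zero_iff.1 hne).1⟩
        refine hi ?_
        rcases Nat.eq_zero_or_pos i.path.length with h0 | hpos
        · have e := eq_vertex_of_length_eq_zero h0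
          rw [hp.1] at e
          refine .inr ⟨x, ⟨hx, ?_⟩, e.symm⟩
          rwa [vertexSupport, Set.mem_ofPred_eq, ← e]
        · exact .inl (Set.mem_iUnion₂.2 ⟨x, hx, hs, hpos, hp⟩)
      · rw [smul_zero]
    have := (hasSum_subtype_iff_of_support_subset (s := compressedIndices S a)
      fun i hi => by
        by_contra hn
        exact hi (by simp only [hout i hn]; rfl)).2 hsum
    convert this using 2 with i
    rw [Function.comp_apply, vertexProj_mul_op_mul_vertexProj]
    by_cases hi : x = (i : FourierIndex V).path.source
    · rw [if_pos hi, if_pos ⟨hi.symm, (path_of_mem_compressedIndices i.2).2.trans hi.symm⟩, mul_one]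
    · rw [if_neg hi, if_neg fun H => hi H.1.symm, mul_zero, smul_zero, zero_smul]
  · rw [vertexProj_mul_diagonalCompression_of_notMem hx]
    convert hasSum_zero with i
    rw [if_neg, mul_zero, zero_smul]
    · rfl
    · intro e
      exact hx (e ▸ (path_of_mem_compressedIndices i.2).1)
    · rfl

theorem mem_vertexSupport {a : GraphOp V} {x : V} :
    x ∈ vertexSupport a ↔ vacuumCoeff x a ≠ 0 := by
  constructor
  · rintro ⟨⟨⟨w, t⟩, hi⟩, e, hne⟩
    change w = vertex x at e
    subst e
    cases t with
    | one => exact hne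
    | star => exact absurd (hi rfl) (lt_irrefl 0)
  · intro h
    exact ⟨.ofVertex x, rfl, h⟩

end Fourier

/-! ### Cumulants of compressed operators -/

section CompressedCumulants

open FreeSemigroupoid

variable {V : Type u} [Quiver.{v} V]

/-- The family `Z (some i)` of operators has the sum `Z none` on every basis vector. -/
def HasSumOnBasis {κ : Type*} (Z : Option κ → GraphOp V) : Prop :=
  ∀ h, HasSum (fun i => Z (some i) (basisVec h)) (Z none (basisVec h))

theorem HasSumOnBasis.vacuumCoeff {κ : Type*} {Z : Option κ → GraphOp V} (hZ : HasSumOnBasis Z)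
    (x : V) : HasSum (fun i => vacuumCoeff x (Z (some i))) (vacuumCoeff x (Z none)) :=
  (hZ (vertex x)).mapL (innerSL ℂ (basisVec (vertex x)))

theorem HasSumOnBasis.mul_left {κ : Type*} {Z : Option κ → GraphOp V} (hZ : HasSumOnBasis Z)
    (c : GraphOp V) : HasSumOnBasis fun t => c * Z t := fun h => (hZ h).mapL c

/-- Since `m ξ_h` is a multiple of one basis vector, only the convergence at that vector is used; a
general `m` would require convergence on infinite combinations. -/
theorem HasSumOnBasis.mul_right {κ : Type*} {Z : Option κ → GraphOp V} (hZ : HasSumOnBasis Z)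
    {m : GraphOp V} (hm : m ∈ columnMonomials V) : HasSumOnBasis fun t => Z t * m := fun h => by
  obtain ⟨c, g, e⟩ := hm h
  simpa only [mul_apply_eq_comp, e, map_smul] using (hZ g).const_smul c

theorem HasSumOnBasis.condExp {κ : Type*} {Z : Option κ → GraphOp V} (hZ : HasSumOnBasis Z) :
    HasSumOnBasis fun t => condExp (Z t) := fun h => by
  simpa only [condExp_basisVec] using (hZ.vacuumCoeff h.source).smul_const (basisVec h)

/-- Partition dependent moments respect sums in the `k`-th argument that converge on basis vectors,
if the later arguments map basis vectors to multiples of basis vectors. -/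
theorem HasSumOnBasis.partitionMoment {κ : Type*} {n : ℕ} (π : NC n) {k : Fin n}
    {Z : Option κ → GraphOp V} (hZ : HasSumOnBasis Z) {b : Fin n → GraphOp V}
    (hb : ∀ j, k < j → b j ∈ columnMonomials V) :
    HasSumOnBasis fun t => partitionMoment _root_.condExp π (Function.update b k (Z t)) :=
  -- Indexing by `Option κ` puts the terms and their sum into one family, so that convergence is a
  -- property `Q` of families.
  partitionMoment_update (Q := HasSumOnBasis) (fun x _ => condExp_mem_columnMonomials x)
    (fun c _ hX => hX.mul_left c) (fun _ _ hm hX => hX.mul_right hm) (fun _ hX => hX.condExp)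
    π hZ hb

/-- A cumulant of positive order whose arguments live on a finite set of vertices is determined by
the vacuum coefficients of the partition dependent moments. -/
theorem cumulant_eq_sum_vertexProj {n : ℕ} (hn : 0 < n) (S : Finset V) (b : Fin n → GraphOp V)
    (hb : ∀ j, ∀ x ∉ S, vertexProj x * b j = 0) :
    cumulant condExp b = ∑ π : NC n, π.moebius •
      ∑ x ∈ S, vacuumCoeff x (partitionMoment condExp π b) • vertexProj x := by
  -- Positive order provides a first argument; the empty moment `1` need not live on `S`.
  obtain ⟨n, rfl⟩ := Nat.exists_eq_succ_of_ne_zero hn.ne'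
  refine Finset.sum_congr rfl fun π _ => congrArg _ ?_
  refine eq_sum_smul_vertexProj (map_momentList condExp_one condExp_condExp_mul _) S
    fun x hx => ?_
  change vertexProj x * momentList condExp π.1 b (List.finRange (n + 1)) = 0
  rw [List.finRange_succ]
  refine mul_momentList_eq_zero (fun a ha => ?_) _ _ (hb 0 x hx)
  rw [← condExp_vertexProj_mul, ha, condExp_zero]

theorem condExp_mul_diagonalCompression {d : GraphOp V} (hd : d ∈ diagonalSubalgebra V)
    (S : Finset V) (a : GraphOp V) :
    condExp (d * diagonalCompression S a) =
      ∑ x ∈ S, (vacuumCoeff x d * vacuumCoeff x a) • vertexProj x := by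
  rw [diagonalSubalgebra_mul_diagonalCompression hd, condExp_sum]
  refine Finset.sum_congr rfl fun x hx => ?_
  rw [condExp_isLinearMap.map_smul, vertexProj_mul_diagonalCompression_of_mem hx,
    condExp_compression, smul_smul]

/-- Expansion of a cumulant over the vertices. -/
theorem hasSum_cumulant_mul_diagonalCompression {n : ℕ} {d : Fin n → GraphOp V}
    (hd : ∀ k, d k ∈ diagonalSubalgebra V) (S : Finset V) (a : GraphOp V) :
    HasSum (fun x : (k : Fin n) → vertexSupport (d k) => (∏ j, vacuumCoeff (x j : V) (d j)) •
        cumulant condExp fun k => vertexProj (x k : V) * diagonalCompression S a)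
      (cumulant condExp fun k => d k * diagonalCompression S a) := by
  classical
  -- Both index sets are compared inside all tuples of vertices: `F` vanishes off the supports of
  -- the `d k` through its coefficient, and off tuples in `S` through its cumulant.
  let F : (Fin n → V) → GraphOp V := fun y => (∏ j, vacuumCoeff (y j) (d j)) •
    cumulant condExp fun k => vertexProj (y k) * diagonalCompression S a
  have hinj : Function.Injective
      fun (x : (k : Fin n) → vertexSupport (d k)) (k : Fin n) => (x k : V) :=
    fun x y e => funext fun k => Subtype.ext (congrFun e k)
  have hsum : cumulant condExp (fun k => d k * diagonalCompression S a) =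
      ∑ y ∈ Fintype.piFinset fun _ : Fin n => S, F y := by
    simp only [diagonalSubalgebra_mul_diagonalCompression (hd _)]
    rw [← cumulantMultilinear_apply condExp_isLinearMap, MultilinearMap.map_sum_finset]
    refine Finset.sum_congr rfl fun y _ => ?_
    rw [MultilinearMap.map_smul_univ, cumulantMultilinear_apply]
  rw [hsum]
  refine (hinj.hasSum_iff (f := F) fun y hy => ?_).2
    (hasSum_sum_of_ne_finset_zero fun y hy => ?_)
  · have : ∃ k, vacuumCoeff (y k) (d k) = 0 := by
      by_contra! H
      exact hy ⟨fun k => ⟨y k, mem_vertexSupport.2 (H k)⟩, rfl⟩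
    obtain ⟨k, hk⟩ := this
    change _ • _ = _
    rw [Finset.prod_eq_zero (Finset.mem_univ k) hk, zero_smul]
  · rw [Fintype.mem_piFinset] at hy
    push Not at hy
    obtain ⟨k, hk⟩ := hy
    change _ • _ = _
    rw [← cumulantMultilinear_apply condExp_isLinearMap, MultilinearMap.map_coord_zero _ k
      (vertexProj_mul_diagonalCompression_of_notMem hk a), smul_zero]

open Classical in
/-- The cumulant of compressions of `a` to vertices is the iterated sum of the cumulants of the
terms of the Fourier series. -/
theorem HasFourierExpansion.hasIteratedSum_cumulant {a : GraphOp V} (ha : HasFourierExpansion a)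
    (S : Finset V) {n : ℕ} (hn : 0 < n) (x : Fin n → V) :
    HasIteratedSum n
      (fun w : Fin n → compressedIndices S a =>
        ((∏ j, graphFourierCoeff a (w j)) *
          (∏ k, if x k = (w k : FourierIndex V).path.source then (1 : ℂ) else 0) *
          moebiusNumber (fun j => (w j : FourierIndex V))) •
          condExp (List.ofFn fun j => (w j : FourierIndex V).op).prod)
      (cumulant condExp fun k => vertexProj (x k) * diagonalCompression S a) := by
  let c : Fin n → compressedIndices S a → GraphOp V := fun k i =>
    (graphFourierCoeff a i * if x k = (i : FourierIndex V).path.source then 1 else 0) •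
      (i : FourierIndex V).op
  -- `Φ` agrees with the cumulant on arguments living on `S`, and it involves only finitely many
  -- scalar coefficients of fixed operators, so scalar convergence gives norm convergence.
  let Φ : (Fin n → GraphOp V) → GraphOp V := fun b => ∑ π : NC n, π.moebius •
    ∑ x ∈ S, vacuumCoeff x (partitionMoment condExp π b) • vertexProj x
  have hsum : ∀ k, HasSumOnBasis
      fun t => t.elim (vertexProj (x k) * diagonalCompression S a) (c k) :=
    fun k => ha.hasSum_compression S (x k)
  have key := hasIteratedSum_of_hasSum_update Φ c
    (fun k => vertexProj (x k) * diagonalCompression S a) fun k b hb =>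
      hasSum_sum fun π _ => HasSum.const_smul _ <| hasSum_sum fun y _ => HasSum.smul_const
        (((hsum k).partitionMoment π fun j hj => by
          obtain ⟨i, hi⟩ := hb j hj
          rw [hi]
          exact smul_op_mem_columnMonomials _ _).vacuumCoeff y) _
  have hproj : ∀ y z : V, y ∉ S → vertexProj y * (vertexProj z * diagonalCompression S a) = 0 :=
    fun y z hy => by
      rw [← mul_assoc, vertexProj_mul_vertexProj]
      split_ifs
      · exact vertexProj_mul_diagonalCompression_of_notMem hy a
      · exact zero_mul _
  convert key using 1
  · funext w
    rw [mul_smul, moebiusNumber_smul_condExp_prod, ← Finset.prod_mul_distrib,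
      ← cumulantMultilinear_apply condExp_isLinearMap, ← MultilinearMap.map_smul_univ,
      cumulantMultilinear_apply]
    refine cumulant_eq_sum_vertexProj hn S _ fun j y hy => ?_
    rw [mul_smul_comm, vertexProj_mul_op_eq_zero (w j).2 hy, smul_zero]
  · exact cumulant_eq_sum_vertexProj hn S _ fun j y hy => hproj y _ hy

end CompressedCumulants

end

-- The theorem

open Classical in
theorem mainTheorem5 {V : Type u} [Quiver.{v} V] [Countable V]
    [∀ x y : V, Countable (x ⟶ y)] (a : GraphOp V) (ha : a ∈ graphWStar V)
    (hF : HasFourierExpansion a) (S : Finset V) :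
    (∀ d ∈ diagonalSubalgebra V,
      cumulant condExp (fun _ : Fin 1 => d * diagonalCompression S a) =
        ∑ x ∈ S with x ∈ vertexSupport d ∩ vertexSupport a,
          (graphFourierCoeff d (.ofVertex x) * graphFourierCoeff a (.ofVertex x)) • vertexProj x) ∧
    ∀ n : ℕ, 1 < n → ∀ d : Fin n → GraphOp V, (∀ k, d k ∈ diagonalSubalgebra V) →
      ∃ T : ((k : Fin n) → vertexSupport (d k)) → GraphOp V,
        (∀ x : (k : Fin n) → vertexSupport (d k),
          HasIteratedSum n
            (fun w : Fin n → compressedIndices S a =>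
              ((∏ j, graphFourierCoeff a (w j)) *
                (∏ k, if (x k : V) = (w k : FourierIndex V).path.source then (1 : ℂ) else 0) *
                moebiusNumber (fun j => (w j : FourierIndex V))) •
                condExp (List.ofFn fun j => (w j : FourierIndex V).op).prod)
            (T x)) ∧
        HasSum (fun x => (∏ j, graphFourierCoeff (d j) (.ofVertex (x j))) • T x)
          (cumulant condExp fun k => d k * diagonalCompression S a) := by
  -- The witness `T x` is the cumulant of the operators `L_{x_k} P_V(a)`; the coefficients at
  -- `.ofVertex x` are the vacuum coefficients by definition.
  refine ⟨fun d hd => ?_, fun n hn d hd => ⟨_, fun x => hF.hasIteratedSum_cumulant S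
    (zero_lt_one.trans hn) fun k => (x k : V), hasSum_cumulant_mul_diagonalCompression hd S a⟩⟩
  rw [cumulant_fin_one, condExp_mul_diagonalCompression hd]
  refine (Finset.sum_filter_of_ne fun x _ hne => ?_).symm
  have := left_ne_zero_of_smul hne
  exact ⟨mem_vertexSupport.2 (left_ne_zero_of_mul this),
    mem_vertexSupport.2 (right_ne_zero_of_mul this)⟩
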